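/- All rings are commutative with unit. Let $A$ be a noetherian ring, let $p,q\ge 0$ be integers, put $n=p+q$, and let $f(u)=u^n+a_1u^{n-1}+\cdots+a_n\in A[u]$ be a monic polynomial of degree $n$. For a ring $R$ and a monic polynomial $F(u)=u^m+r_1u^{m-1}+\cdots+r_m\in R[u]$, the splitting ring $\mathrm{Split}_R(F)$ is the quotient of $R[\xi_1,\dots,\xi_m]$ by the ideal generated by the elements $r_i-(-1)^ie_i(\xi_1,\dots,\xi_m)$ for $1\le i\le m$, where $e_i$ is the $i$th elementary symmetric polynomial; it is the universal $R$-algebra over which $F(u)=\prod_{i=1}^m(u-\xi_i)$. The $(p,q)$-factorization ring $C=\mathrm{Fact}^{p,q}_A(f)$ is the quotient of $A[b_1,\dots,b_p,c_1,\dots,c_q]$ by the ideal generated by the coefficients of $f(u)-g(u)h(u)$, where $g(u)=u^p+b_1u^{p-1}+\cdots+b_p$ and $h(u)=u^q+c_1u^{q-1}+\cdots+c_q$; it is the universal $A$-algebra over which $f=gh$ with $g,h$ monic of degrees $p,q$. Regard $g$ and $h$ as polynomials over $C$, and put $B=\mathrm{Split}_A(f)$. Then: (a) There is a natural isomorphism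 of $A$-algebras $B\cong \mathrm{Split}_C(g)\otimes_C\mathrm{Split}_C(h)$: if $\eta_1,\dots,\eta_p$ and $\eta_{p+1},\dots,\eta_{p+q}$ denote the tautological roots in $\mathrm{Split}_C(g)$ and $\mathrm{Split}_C(h)$, it sends $\xi_i$ to $\eta_i\otimes 1$ for $i\le p$ and to $1\otimes\eta_i$ for $i>p$. (b) As an $A$-module, $C$ is free of rank $\binom{n}{p}$. (c) The map $A\to C$ is syntomic, that is, flat, of finite presentation, and with all fibers local complete intersections. (d) For every integer $k\ge 0$, if $A$ satisfies Serre's condition $(S_k)$, then so does $C$. In particular, if $A$ is Cohen–Macaulay, then so is $C$. (e) If $B$ is reduced, then $C$ is reduced; if $B$ is an integral domain, then $C$ is an integral domain; if $B$ is normal (all localizations at prime ideals are integrally closed domains), then $C$ is normal. -/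

import Mathlib

open scoped TensorProduct Polynomial

noncomputable section

universe u v

/-! ### Splitting rings -/

/-- The ideal of `R[ξ₁, …, ξₙ]` generated by the elements `aᵢ - (-1)ⁱ eᵢ(ξ₁, …, ξₙ)` for
`1 ≤ i ≤ n`, where `f = uⁿ + a₁ uⁿ⁻¹ + ⋯ + aₙ` and `eᵢ` is the `i`-th elementary symmetric
polynomial. -/
def splittingIdeal {R : Type u} [CommRing R] {n : ℕ} (f : Polynomial.MonicDegreeEq R n) :
    Ideal (MvPolynomial (Fin n) R) :=
  Ideal.span {x | ∃ i : ℕ, 1 ≤ i ∧ i ≤ n ∧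
    x = MvPolynomial.C (f.1.coeff (n - i)) - (-1) ^ i * MvPolynomial.esymm (Fin n) R i}

/-- The splitting ring of a monic polynomial `f` of degree `n`. -/
def SplittingRing {R : Type u} [CommRing R] {n : ℕ} (f : Polynomial.MonicDegreeEq R n) : Type u :=
  MvPolynomial (Fin n) R ⧸ splittingIdeal f

namespace SplittingRing

variable {R : Type u} [CommRing R] {n : ℕ} (f : Polynomial.MonicDegreeEq R n)

instance : CommRing (SplittingRing f) :=
  inferInstanceAs (CommRing (MvPolynomial (Fin n) R ⧸ splittingIdeal f))

/-- If `R` is an algebra over `A`, then so is the splitting ring (in particular for `A = R`). -/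
instance {A : Type v} [CommRing A] [Algebra A R] : Algebra A (SplittingRing f) :=
  inferInstanceAs (Algebra A (MvPolynomial (Fin n) R ⧸ splittingIdeal f))

instance {A : Type v} [CommRing A] [Algebra A R] : IsScalarTower A R (SplittingRing f) :=
  inferInstanceAs (IsScalarTower A R (MvPolynomial (Fin n) R ⧸ splittingIdeal f))

/-- The tautological roots `ξᵢ` of `f` in the splitting ring. -/
def root (i : Fin n) : SplittingRing f :=
  Ideal.Quotient.mk (splittingIdeal f) (MvPolynomial.X i)

end SplittingRing

/-! ### Factorization rings -/

/-- The `(p, q)`-factorization ring of a monic polynomial `f` of degree `p + q`: the universal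
`A`-algebra over which `f` is the product of a monic polynomial of degree `p` and a monic
polynomial of degree `q`. Mathlib's construction adjoins to `A` the non-leading coefficients of
two monic polynomials `g`, `h` of degrees `p`, `q`, and imposes exactly the coefficients of
`f = g h` as relations. -/
abbrev FactorizationRing {A : Type u} [CommRing A] (p q : ℕ)
    (f : Polynomial.MonicDegreeEq A (p + q)) : Type u :=
  Polynomial.UniversalFactorizationRing p q rfl f

namespace FactorizationRing

variable {A : Type u} [CommRing A] (p q : ℕ) (f : Polynomial.MonicDegreeEq A (p + q))

/-- The tautological monic factor `g` of degree `p`. -/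
abbrev fstFactor : Polynomial.MonicDegreeEq (FactorizationRing p q f) p :=
  Polynomial.UniversalFactorizationRing.factor₁ p q rfl f

/-- The tautological monic factor `h` of degree `q`. -/
abbrev sndFactor : Polynomial.MonicDegreeEq (FactorizationRing p q f) q :=
  Polynomial.UniversalFactorizationRing.factor₂ p q rfl f

end FactorizationRing

/-! ### Syntomic algebras -/

/-- A `k`-algebra `S` is a global complete intersection over the field `k` if it is zero or has a
presentation `S ≅ k[x₁, …, xₙ]/(f₁, …, f_c)` with `dim S = n - c`. -/
def IsGlobalCompleteIntersection (k : Type u) (S : Type v) [Field k] [CommRing S] [Algebra k S] :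
    Prop :=
  Subsingleton S ∨
    ∃ (n c : ℕ) (f : Fin c → MvPolynomial (Fin n) k),
      Nonempty (S ≃ₐ[k] (MvPolynomial (Fin n) k ⧸ Ideal.span (Set.range f))) ∧
        ringKrullDim S + (c : WithBot ℕ∞) = (n : WithBot ℕ∞)

/-- A `k`-algebra `S` is a local complete intersection over the field `k` if `Spec S` is covered
by basic open sets `D(g)` such that each `S_g` is a global complete intersection over `k`. -/
def IsLocalCompleteIntersection (k : Type u) (S : Type v) [Field k] [CommRing S] [Algebra k S] :
    Prop :=
  ∃ s : Set S, Ideal.span s = ⊤ ∧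
    ∀ g ∈ s, IsGlobalCompleteIntersection k (Localization.Away g)

/-- An `A`-algebra `S` is syntomic if it is flat, of finite presentation, and all its fibres
`κ(P) ⊗ S` are local complete intersections over the residue fields `κ(P)`. -/
structure IsSyntomicAlgebra (A : Type u) (S : Type v) [CommRing A] [CommRing S] [Algebra A S] :
    Prop where
  flat : Module.Flat A S
  finitePresentation : Algebra.FinitePresentation A S
  fibre : ∀ (P : Ideal A) [P.IsPrime], IsLocalCompleteIntersection P.ResidueField (P.Fiber S)

/-! ### Depth, Serre's conditions, Cohen--Macaulay rings, normal rings -/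

/-- The depth of a local ring: the supremum of the lengths of the regular sequences contained in
the maximal ideal. -/
def localRingDepth (R : Type u) [CommRing R] [IsLocalRing R] : ℕ∞ :=
  ⨆ rs ∈ {rs : List R | RingTheory.Sequence.IsRegular R rs ∧
    ∀ r ∈ rs, r ∈ IsLocalRing.maximalIdeal R}, (rs.length : ℕ∞)

/-- Serre's condition `(S_k)`: the ring is noetherian and
`depth R_P ≥ min (k, dim R_P)` for all primes `P`. -/
structure SerreConditionS (k : ℕ) (R : Type u) [CommRing R] : Prop where
  noetherian : IsNoetherianRing R
  min_le_depth : ∀ (P : Ideal R) [P.IsPrime],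
    min (k : WithBot ℕ∞) (ringKrullDim (Localization.AtPrime P)) ≤
      (localRingDepth (Localization.AtPrime P) : WithBot ℕ∞)

/-- A ring is Cohen--Macaulay if it is noetherian and `depth R_M = dim R_M` for all maximal
ideals `M`. -/
structure IsCohenMacaulay (R : Type u) [CommRing R] : Prop where
  noetherian : IsNoetherianRing R
  depth_eq_dim : ∀ (M : Ideal R) [M.IsMaximal],
    (localRingDepth (Localization.AtPrime M) : WithBot ℕ∞) =
      ringKrullDim (Localization.AtPrime M)

/-- A ring is normal if its localizations at all primes are integrally closed domains. -/
structure IsNormalRing (R : Type u) [CommRing R] : Prop where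
  isDomain : ∀ (P : Ideal R) [P.IsPrime], IsDomain (Localization.AtPrime P)
  isIntegrallyClosed : ∀ (P : Ideal R) [P.IsPrime], IsIntegrallyClosed (Localization.AtPrime P)

end

/-! ### Vieta's formulas and the universal property of splitting rings. -/

noncomputable section

/-! Write `B`, `C` for the splitting and factorization rings. Choosing `p` of the roots and
collecting the rest gives a factorization of `f` over `B`, and splitting both factors recovers `B`;
universal properties turn this into the tensor decomposition (a). Splitting off one root at a time
shows that splitting rings are free of rank `n!`, so `B` is free over `A` of rank `n!` and over `C`
of rank `p! q!`.

For (b), the determinant of `p` elements of `A[X]/(f)`, read in the basis of powers of the root of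
`C[X]/(g)`, is an `A`-linear map from the `p`-th exterior power of `A[X]/(f)` to `C`. It is onto:
its image contains `1` and is stable under the coefficients of `g`, which generate `C`. It is
injective because `p! q!` copies of either side are isomorphic to `A^(n!)`, and a surjection between
isomorphic finite modules is bijective.

The rest follows from finiteness and flatness. Fibres are finite with as many equations as unknowns;
depth cannot drop along flat local maps, nor height rise along integral ones; and the properties in
(e) descend along the faithfully flat map from `C` to `B`. -/

open Polynomial in
/-- A monic polynomial of degree `n` is the product of the `X - xᵢ` if and only if its
coefficients are, up to sign, the elementary symmetric polynomials in the `xᵢ`. -/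
theorem Polynomial.MonicDegreeEq.eq_prod_X_sub_C_iff {S : Type*} [CommRing S] {n : ℕ}
    (F : MonicDegreeEq S n) (x : Fin n → S) :
    F.1 = ∏ i, (X - C (x i)) ↔ ∀ i, 1 ≤ i → i ≤ n →
      F.1.coeff (n - i) = (-1) ^ i * MvPolynomial.aeval x (MvPolynomial.esymm (Fin n) S i) := by
  have key : ∀ k ≤ n, (∏ i, (X - C (x i))).coeff k =
      (-1) ^ (n - k) * MvPolynomial.aeval x (MvPolynomial.esymm (Fin n) S (n - k)) := by
    intro k hk
    have := Multiset.prod_X_sub_C_coeff (Finset.univ.val.map x) (k := k) (by simpa using hk)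
    rw [Multiset.map_map] at this
    rw [MvPolynomial.aeval_esymm_eq_multiset_esymm]
    refine Eq.trans ?_ (this.trans ?_)
    · rfl
    · simp only [Multiset.card_map, Finset.card_val, Finset.card_univ, Fintype.card_fin]
  constructor
  · intro h i hi hin
    rw [h, key _ (Nat.sub_le _ _), Nat.sub_sub_self hin]
  · intro h
    ext k
    rcases lt_trichotomy k n with hk | rfl | hk
    · rw [key k hk.le, ← h (n - k) (by lia) (by lia), Nat.sub_sub_self hk.le]
    · rw [F.2.1, key k le_rfl]
      simp
    · rw [F.2.2 k hk, coeff_eq_zero_of_natDegree_lt]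
      refine lt_of_le_of_lt (natDegree_prod_le _ _) (lt_of_le_of_lt ?_ hk)
      refine (Finset.sum_le_card_nsmul _ _ 1 fun i _ ↦ natDegree_X_sub_C_le (x i)).trans ?_
      simp

namespace SplittingRing

open Polynomial

variable {R : Type u} [CommRing R] {n : ℕ} (f : MonicDegreeEq R n)

theorem map_eq_prod_X_sub_C_iff {S : Type*} [CommRing S] [Algebra R S] (x : Fin n → S) :
    f.1.map (algebraMap R S) = ∏ i, (X - C (x i)) ↔
      ∀ a ∈ splittingIdeal f, MvPolynomial.aeval x a = 0 := by
  have h1 := (f.map (algebraMap R S)).eq_prod_X_sub_C_iff x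
  rw [MonicDegreeEq.map_coe] at h1
  rw [h1]
  have h2 (i : ℕ) : MvPolynomial.aeval x (MvPolynomial.esymm (Fin n) S i) =
      MvPolynomial.aeval x (MvPolynomial.esymm (Fin n) R i) := by
    simp [MvPolynomial.aeval_esymm_eq_multiset_esymm]
  have h3 : (∀ a ∈ splittingIdeal f, MvPolynomial.aeval x a = 0) ↔
      splittingIdeal f ≤ RingHom.ker (MvPolynomial.aeval (R := R) x) := Iff.rfl
  rw [h3, splittingIdeal, Ideal.span_le]
  constructor
  · rintro h _ ⟨i, hi, hin, rfl⟩
    have := h i hi hin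
    rw [h2, coeff_map] at this
    simp [RingHom.mem_ker, this]
  · intro h i hi hin
    have := h ⟨i, hi, hin, rfl⟩
    rw [SetLike.mem_coe, RingHom.mem_ker, map_sub, sub_eq_zero] at this
    simpa [h2] using this

theorem map_eq_prod_root :
    f.1.map (algebraMap R (SplittingRing f)) = ∏ i, (X - C (root f i)) := by
  rw [map_eq_prod_X_sub_C_iff]
  intro a ha
  let π : MvPolynomial (Fin n) R →ₐ[R] SplittingRing f := Ideal.Quotient.mkₐ R (splittingIdeal f)
  have : MvPolynomial.aeval (root f) = π :=
    MvPolynomial.algHom_ext fun i ↦ MvPolynomial.aeval_X _ i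
  exact (DFunLike.congr_fun this a).trans (Ideal.Quotient.eq_zero_iff_mem.mpr ha)

theorem algHom_ext {S : Type*} [CommRing S] [Algebra R S] {φ ψ : SplittingRing f →ₐ[R] S}
    (h : ∀ i, φ (root f i) = ψ (root f i)) : φ = ψ :=
  Ideal.Quotient.algHom_ext R (MvPolynomial.algHom_ext h)

/-- The algebra homomorphism out of the splitting ring given by a splitting of `f`. -/
def lift {S : Type*} [CommRing S] [Algebra R S] (x : Fin n → S)
    (h : f.1.map (algebraMap R S) = ∏ i, (X - C (x i))) : SplittingRing f →ₐ[R] S :=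
  Ideal.Quotient.liftₐ (splittingIdeal f) (MvPolynomial.aeval x)
    ((map_eq_prod_X_sub_C_iff f x).mp h)

@[simp]
theorem lift_root {S : Type*} [CommRing S] [Algebra R S] (x : Fin n → S)
    (h : f.1.map (algebraMap R S) = ∏ i, (X - C (x i))) (i : Fin n) :
    lift f x h (root f i) = x i :=
  MvPolynomial.aeval_X x i

theorem map_map_eq_prod {S : Type*} [CommRing S] [Algebra R S] (φ : SplittingRing f →ₐ[R] S) :
    f.1.map (algebraMap R S) = ∏ i, (X - C (φ (root f i))) := by
  rw [← φ.comp_algebraMap, ← Polynomial.map_map, map_eq_prod_root, Polynomial.map_prod]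
  simp

end SplittingRing

/-! ### Freeness of splitting rings, one root at a time. -/

open Polynomial AdjoinRoot in
/-- `R[X]/(f)` is free with `n` basis vectors if `f` is monic of degree `n`. -/
theorem AdjoinRoot.nonempty_basis_of_monicDegreeEq {R : Type*} [CommRing R] {n : ℕ}
    (f : MonicDegreeEq R n) :
    ∃ b : Module.Basis (Fin n) R (AdjoinRoot f.1), ∀ i, b i = root f.1 ^ (i : ℕ) := by
  cases subsingleton_or_nontrivial R
  · have := Module.subsingleton R (AdjoinRoot f.1)
    exact ⟨.ofRepr default, fun i ↦ Subsingleton.elim _ _⟩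
  · refine ⟨(powerBasis' f.monic).basis.reindex (finCongr f.natDegree), fun i ↦ ?_⟩
    simp only [Module.Basis.reindex_apply, PowerBasis.coe_basis, powerBasis'_gen]
    rfl

namespace SplittingRing

open Polynomial

theorem exists_eq_X_sub_C_mul {R : Type u} [CommRing R] {n : ℕ}
    (f : MonicDegreeEq R (n + 1)) : ∃ g : MonicDegreeEq (AdjoinRoot f.1) n,
      f.1.map (algebraMap R (AdjoinRoot f.1)) = (X - C (AdjoinRoot.root f.1)) * g.1 := by
  -- Over the zero ring degrees carry no information, but any cofactor works.
  cases subsingleton_or_nontrivial (AdjoinRoot f.1)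
  · exact ⟨⟨0, Subsingleton.elim _ _, fun _ _ ↦ rfl⟩, Subsingleton.elim _ _⟩
  have h : IsRoot (f.1.map (algebraMap R (AdjoinRoot f.1))) (AdjoinRoot.root f.1) :=
    AdjoinRoot.isRoot_root f.1
  obtain ⟨g, hg⟩ := dvd_iff_isRoot.mpr h
  have hm : g.Monic := (monic_X_sub_C _).of_mul_monic_left (hg ▸ f.monic.map _)
  refine ⟨.mk g hm ?_, hg⟩
  have h1 : (f.1.map (algebraMap R (AdjoinRoot f.1))).natDegree = n + 1 :=
    (f.map (algebraMap R (AdjoinRoot f.1))).natDegree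
  rw [hg, (monic_X_sub_C _).natDegree_mul hm, natDegree_X_sub_C] at h1
  lia

/-- Splitting off one root: the splitting ring of `f` is the splitting ring of
`f / (X - ξ)` over `R[ξ] = R[X]/(f)`. -/
theorem nonempty_algEquiv_of_eq_X_sub_C_mul {R : Type u} [CommRing R] {n : ℕ}
    (f : MonicDegreeEq R (n + 1)) (g : MonicDegreeEq (AdjoinRoot f.1) n)
    (h : f.1.map (algebraMap R (AdjoinRoot f.1)) = (X - C (AdjoinRoot.root f.1)) * g.1) :
    Nonempty (SplittingRing f ≃ₐ[R] SplittingRing g) := by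
  have hroot : f.1.aeval (root f 0) = 0 := by
    rw [← eval_map_algebraMap, map_eq_prod_root, Fin.prod_univ_succ]
    simp
  let φ : AdjoinRoot f.1 →ₐ[R] SplittingRing f :=
    AdjoinRoot.liftAlgHom f.1 (Algebra.ofId _ _) (root f 0) hroot
  let : Algebra (AdjoinRoot f.1) (SplittingRing f) := φ.toRingHom.toAlgebra
  have : IsScalarTower R (AdjoinRoot f.1) (SplittingRing f) :=
    .of_algebraMap_eq fun r ↦ (φ.commutes r).symm
  have hφ : algebraMap (AdjoinRoot f.1) (SplittingRing f) (AdjoinRoot.root f.1) = root f 0 :=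
    AdjoinRoot.liftAlgHom_root ..
  have hg : g.1.map (algebraMap (AdjoinRoot f.1) (SplittingRing f)) =
      ∏ i : Fin n, (X - C (root f i.succ)) := by
    refine (monic_X_sub_C (root f 0)).isRegular.left ?_
    have := congr(($h).map (algebraMap (AdjoinRoot f.1) (SplittingRing f)))
    rw [Polynomial.map_map, ← IsScalarTower.algebraMap_eq, map_eq_prod_root,
      Fin.prod_univ_succ] at this
    simpa [hφ] using this.symm
  let β : SplittingRing g →ₐ[AdjoinRoot f.1] SplittingRing f := lift g _ hg
  have hf : f.1.map (algebraMap R (SplittingRing g)) =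
      ∏ i, (X - C ((Fin.cons (algebraMap (AdjoinRoot f.1) _ (AdjoinRoot.root f.1)) (root g) :
        Fin (n + 1) → SplittingRing g) i)) := by
    rw [IsScalarTower.algebraMap_eq R (AdjoinRoot f.1), ← Polynomial.map_map, h,
      Fin.prod_univ_succ, Polynomial.map_mul, map_eq_prod_root]
    simp
  let α : SplittingRing f →ₐ[R] SplittingRing g := lift f _ hf
  have hα0 : α (root f 0) = algebraMap (AdjoinRoot f.1) _ (AdjoinRoot.root f.1) := by simp [α]
  have hαs (i : Fin n) : α (root f i.succ) = root g i := by simp [α]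
  have hβs (i : Fin n) : β (root g i) = root f i.succ := by simp [β]
  have hβα : (β.restrictScalars R).comp α = AlgHom.id R _ := by
    refine algHom_ext f fun i ↦ ?_
    cases i using Fin.cases with
    | zero => simp [hα0, hφ]
    | succ i => simp [hαs, hβs]
  -- Linearity over `R[ξ]` is needed to test the composite on the roots of `g` alone.
  have hα : ∀ a, α (algebraMap (AdjoinRoot f.1) _ a) = algebraMap (AdjoinRoot f.1) _ a := by
    have : α.comp (IsScalarTower.toAlgHom R (AdjoinRoot f.1) _) =
        IsScalarTower.toAlgHom R (AdjoinRoot f.1) _ := by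
      refine AdjoinRoot.algHom_ext ?_
      simp [hφ, hα0]
    exact DFunLike.congr_fun this
  let α' : SplittingRing f →ₐ[AdjoinRoot f.1] SplittingRing g := { α with commutes' := hα }
  have hαβ : α'.comp β = AlgHom.id _ _ := by
    refine algHom_ext g fun i ↦ ?_
    exact (congrArg α (hβs i)).trans (hαs i)
  exact ⟨AlgEquiv.ofAlgHom α (β.restrictScalars R)
    (AlgHom.ext fun x ↦ DFunLike.congr_fun hαβ x) hβα⟩

/-- The splitting ring of a monic polynomial of degree `n` is free of rank `n!`. -/
theorem nonempty_basis {R : Type u} [CommRing R] {n : ℕ} (f : MonicDegreeEq R n) :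
    Nonempty (Module.Basis (Fin n.factorial) R (SplittingRing f)) := by
  induction n generalizing R with
  | zero =>
    have h : Function.Bijective (algebraMap R (SplittingRing f)) := by
      have h1 : f.1.map (algebraMap R R) = ∏ i, (X - C ((Fin.elim0 : Fin 0 → R) i)) := by
        have : f.1 = 1 := by
          ext k
          rw [f.coeff_of_ge k (Nat.zero_le k), coeff_one]
        simp [this]
      have h2 : (Algebra.ofId R _).comp (lift f _ h1) = AlgHom.id R _ :=
        algHom_ext f fun i ↦ i.elim0
      refine ⟨Function.LeftInverse.injective (g := lift f _ h1) fun r ↦ (lift f _ h1).commutes r,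
        fun x ↦ ⟨_, DFunLike.congr_fun h2 x⟩⟩
    let e : R ≃ₗ[R] SplittingRing f :=
      LinearEquiv.ofBijective (Algebra.linearMap R (SplittingRing f)) h
    exact ⟨((Module.Basis.singleton (Fin 1) R).map e)⟩
  | succ n ih =>
    obtain ⟨g, hg⟩ := exists_eq_X_sub_C_mul f
    obtain ⟨e⟩ := nonempty_algEquiv_of_eq_X_sub_C_mul f g hg
    obtain ⟨b⟩ := ih g
    obtain ⟨c, -⟩ := AdjoinRoot.nonempty_basis_of_monicDegreeEq f
    -- The tower has rank `(n + 1) * n!`, which is `(n + 1)!` by definition.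
    exact ⟨((c.smulTower b).reindex finProdFinEquiv).map e.symm.toLinearEquiv⟩

end SplittingRing

/-! ### Factorization rings and the tensor decomposition. -/

section

open Polynomial

/-- The product of the `X - xᵢ`, as a monic polynomial of degree `n`. -/
def Polynomial.MonicDegreeEq.ofRoots {S : Type*} [CommRing S] {n : ℕ} (x : Fin n → S) :
    MonicDegreeEq S n :=
  ⟨∏ i, (X - C (x i)), by
    nontriviality S
    exact (MonicDegreeEq.mk (∏ i, (X - C (x i))) (monic_prod_of_monic _ _ fun i _ ↦ monic_X_sub_C _)
      (by simp [natDegree_prod_of_monic _ _ fun i _ ↦ monic_X_sub_C (x i)])).2⟩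

namespace FactorizationRing

variable {A : Type u} [CommRing A] (p q : ℕ) (f : MonicDegreeEq A (p + q))

theorem map_eq_fstFactor_mul_sndFactor :
    f.1.map (algebraMap A (FactorizationRing p q f)) =
      (fstFactor p q f).1 * (sndFactor p q f).1 :=
  (UniversalFactorizationRing.factor₁_mul_factor₂ p q rfl f).symm

theorem algHom_ext {S : Type*} [CommRing S] [Algebra A S] {φ ψ : FactorizationRing p q f →ₐ[A] S}
    (h1 : (fstFactor p q f).1.map φ.toRingHom = (fstFactor p q f).1.map ψ.toRingHom)
    (h2 : (sndFactor p q f).1.map φ.toRingHom = (sndFactor p q f).1.map ψ.toRingHom) : φ = ψ :=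
  (UniversalFactorizationRing.homEquiv S p q rfl f).injective
    (Subtype.ext (Prod.ext (Subtype.ext h1) (Subtype.ext h2)))

theorem exists_algHom {S : Type*} [CommRing S] [Algebra A S] (g : MonicDegreeEq S p)
    (h : MonicDegreeEq S q) (hgh : f.1.map (algebraMap A S) = g.1 * h.1) :
    ∃ φ : FactorizationRing p q f →ₐ[A] S, (fstFactor p q f).1.map φ.toRingHom = g.1 ∧
      (sndFactor p q f).1.map φ.toRingHom = h.1 := by
  obtain ⟨φ, hφ⟩ := (UniversalFactorizationRing.homEquiv S p q rfl f).surjective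
    ⟨(g, h), hgh.symm⟩
  refine ⟨φ, ?_, ?_⟩
  · exact congrArg (fun x ↦ x.1.1.1) hφ
  · exact congrArg (fun x ↦ x.1.2.1) hφ

/-- The splitting ring of `f = g h` is the tensor product over the factorization ring of the
splitting rings of `g` and `h`. -/
theorem exists_splittingRing_algEquiv :
    ∃ e : SplittingRing f ≃ₐ[A]
        (SplittingRing (fstFactor p q f) ⊗[FactorizationRing p q f]
          SplittingRing (sndFactor p q f)),
      (∀ i : Fin p, e (SplittingRing.root f (Fin.castAdd q i)) =
        SplittingRing.root (fstFactor p q f) i ⊗ₜ[FactorizationRing p q f] 1) ∧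
      (∀ j : Fin q, e (SplittingRing.root f (Fin.natAdd p j)) =
        1 ⊗ₜ[FactorizationRing p q f] SplittingRing.root (sndFactor p q f) j) := by
  let G := SplittingRing (fstFactor p q f)
  let H := SplittingRing (sndFactor p q f)
  let K := FactorizationRing p q f
  let T := G ⊗[K] H
  let η : Fin p → T := fun i ↦ SplittingRing.root (fstFactor p q f) i ⊗ₜ 1
  let θ : Fin q → T := fun j ↦ 1 ⊗ₜ SplittingRing.root (sndFactor p q f) j
  have hη : (fstFactor p q f).1.map (algebraMap K T) = ∏ i, (X - C (η i)) :=
    SplittingRing.map_map_eq_prod (fstFactor p q f)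
      (Algebra.TensorProduct.includeLeft : G →ₐ[K] T)
  have hθ : (sndFactor p q f).1.map (algebraMap K T) = ∏ i, (X - C (θ i)) :=
    SplittingRing.map_map_eq_prod (sndFactor p q f)
      (Algebra.TensorProduct.includeRight : H →ₐ[K] T)
  have hf : f.1.map (algebraMap A T) = ∏ i, (X - C (Fin.append η θ i)) := by
    rw [IsScalarTower.algebraMap_eq A K T, ← Polynomial.map_map, map_eq_fstFactor_mul_sndFactor,
      Polynomial.map_mul, hη, hθ, Fin.prod_univ_add]
    simp
  let α : SplittingRing f →ₐ[A] T := SplittingRing.lift f _ hf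
  have hα1 (i : Fin p) : α (SplittingRing.root f (Fin.castAdd q i)) = η i := by simp [α]
  have hα2 (j : Fin q) : α (SplittingRing.root f (Fin.natAdd p j)) = θ j := by simp [α]
  -- Grouping the first `p` and last `q` linear factors of `f` makes its splitting ring an algebra
  -- over the factorization ring.
  obtain ⟨γ, hγ1, hγ2⟩ := exists_algHom p q f
    (.ofRoots fun i ↦ SplittingRing.root f (Fin.castAdd q i))
    (.ofRoots fun i ↦ SplittingRing.root f (Fin.natAdd p i)) <| by
      rw [SplittingRing.map_eq_prod_root, Fin.prod_univ_add]
      rfl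
  let : Algebra K (SplittingRing f) := γ.toRingHom.toAlgebra
  have : IsScalarTower A K (SplittingRing f) :=
    .of_algebraMap_eq fun r ↦ (γ.commutes r).symm
  let β1 : G →ₐ[K] SplittingRing f := SplittingRing.lift (fstFactor p q f) _ hγ1
  let β2 : H →ₐ[K] SplittingRing f := SplittingRing.lift (sndFactor p q f) _ hγ2
  let β : T →ₐ[K] SplittingRing f := Algebra.TensorProduct.lift β1 β2 fun _ _ ↦ .all _ _
  have hβ1 (i : Fin p) : β (η i) = SplittingRing.root f (Fin.castAdd q i) := by
    refine (Algebra.TensorProduct.lift_tmul β1 β2 _ _ 1).trans ?_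
    rw [map_one, mul_one]
    exact SplittingRing.lift_root ..
  have hβ2 (j : Fin q) : β (θ j) = SplittingRing.root f (Fin.natAdd p j) := by
    refine (Algebra.TensorProduct.lift_tmul β1 β2 _ 1 _).trans ?_
    rw [map_one, one_mul]
    exact SplittingRing.lift_root ..
  have hβα : (β.restrictScalars A).comp α = AlgHom.id A _ := by
    refine SplittingRing.algHom_ext f fun i ↦ ?_
    cases i using Fin.addCases with
    | left i => exact (congrArg β (hα1 i)).trans (hβ1 i)
    | right i => exact (congrArg β (hα2 i)).trans (hβ2 i)
  -- `α` was built over `A` only. It is `K`-linear since both maps from `K` to `T` induce the same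
  -- factorization of `f`.
  have hα : ∀ a : K, α (algebraMap K _ a) = algebraMap K T a := by
    have : α.comp (IsScalarTower.toAlgHom A K _) = IsScalarTower.toAlgHom A K T := by
      refine algHom_ext p q f ?_ ?_
      · refine Eq.trans ?_ hη.symm
        refine (Polynomial.map_map γ.toRingHom α.toRingHom _).symm.trans ?_
        rw [hγ1, MonicDegreeEq.ofRoots, Polynomial.map_prod]
        simp [hα1]
      · refine Eq.trans ?_ hθ.symm
        refine (Polynomial.map_map γ.toRingHom α.toRingHom _).symm.trans ?_
        rw [hγ2, MonicDegreeEq.ofRoots, Polynomial.map_prod]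
        simp [hα2]
    exact DFunLike.congr_fun this
  let α' : SplittingRing f →ₐ[K] T := { α with commutes' := hα }
  have hαβ : α'.comp β = AlgHom.id _ _ := by
    refine Algebra.TensorProduct.ext ?_ ?_
    · refine SplittingRing.algHom_ext _ fun i ↦ ?_
      exact (congrArg α (hβ1 i)).trans (hα1 i)
    · refine SplittingRing.algHom_ext _ fun i ↦ ?_
      exact (congrArg α (hβ2 i)).trans (hα2 i)
  exact ⟨AlgEquiv.ofAlgHom α (β.restrictScalars A)
    (AlgHom.ext fun x ↦ DFunLike.congr_fun hαβ x) hβα, hα1, hα2⟩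

end FactorizationRing

end

/-! ### Exterior powers and the rank of the factorization ring. -/

section

open Polynomial

/-- Over the coefficient ring of a polynomial, a monic polynomial of degree `n` is the
characteristic polynomial of multiplication by its root. -/
theorem AdjoinRoot.charpoly_leftMulMatrix_root {R : Type*} [CommRing R] {n : ℕ}
    (g : MonicDegreeEq R n) (b : Module.Basis (Fin n) R (AdjoinRoot g.1)) :
    (Algebra.leftMulMatrix b (AdjoinRoot.root g.1)).charpoly = g.1 := by
  nontriviality R
  set U := Algebra.leftMulMatrix b (AdjoinRoot.root g.1)
  -- By Cayley–Hamilton the root of `g` is a root of the characteristic polynomial; both polynomials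
  -- are monic of degree `n`.
  have h : g.1 ∣ U.charpoly := by
    rw [← AdjoinRoot.mk_eq_zero, ← AdjoinRoot.aeval_eq]
    apply Algebra.leftMulMatrix_injective b
    rw [← Polynomial.aeval_algHom_apply, map_zero]
    exact Matrix.aeval_self_charpoly U
  refine (eq_of_monic_of_dvd_of_natDegree_le g.monic (Matrix.charpoly_monic U) h ?_)
  simp

/-- Expansion of `χ_U(t) det F = det (t F - U F)` into determinants formed from columns of
`F` and of `U F`. -/
theorem Matrix.charpoly_mul_C_det {R : Type*} [CommRing R] {n : ℕ}
    (U F : Matrix (Fin n) (Fin n) R) :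
    U.charpoly * C F.det = ∑ s : Finset (Fin n),
      X ^ s.card * (-1) ^ sᶜ.card *
        C (Matrix.of fun j i ↦ if j ∈ s then F i j else (U * F) i j).det := by
  -- Row `j` here is column `j` of `F`: `detRowAlternating` is multilinear in rows, so everything is
  -- transposed.
  let r₁ : Fin n → Fin n → R[X] := fun j i ↦ X * C (F i j)
  let r₂ : Fin n → Fin n → R[X] := fun j i ↦ (-1) * C ((U * F) i j)
  have h1 : U.charpoly * C F.det = Matrix.detRowAlternating (r₁ + r₂) := by
    rw [Matrix.charpoly, RingHom.map_det, ← Matrix.det_mul, ← Matrix.det_transpose]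
    refine congrArg Matrix.det (Matrix.ext fun i j ↦ ?_)
    simp [r₁, r₂, Matrix.charmatrix, Matrix.mul_apply, Matrix.scalar_apply,
      Matrix.diagonal_apply, add_mul, sub_eq_add_neg]
  rw [h1]
  refine (Matrix.detRowAlternating.toMultilinearMap.map_add_univ r₁ r₂).trans
    (Finset.sum_congr rfl fun s _ ↦ ?_)
  have h2 : s.piecewise r₁ r₂ = fun j ↦ (if j ∈ s then X else (-1 : R[X])) •
      fun i ↦ C (if j ∈ s then F i j else (U * F) i j) := by
    funext j
    by_cases hj : j ∈ s
    · rw [Finset.piecewise_eq_of_mem _ _ _ hj]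
      simp only [if_pos hj]
      rfl
    · rw [Finset.piecewise_eq_of_notMem _ _ _ hj]
      simp only [if_neg hj]
      rfl
  rw [h2]
  refine (Matrix.detRowAlternating.toMultilinearMap.map_smul_univ _ _).trans ?_
  rw [RingHom.map_det, smul_eq_mul]
  congr 1
  rw [Finset.prod_ite, Finset.prod_const, Finset.prod_const, Finset.filter_mem_eq_inter,
    Finset.univ_inter, Finset.filter_notMem_eq_sdiff, Finset.compl_eq_univ_sdiff]

section

variable {A K : Type*} [CommRing A] [CommRing K] [Algebra A K] {n p : ℕ}
  (f : MonicDegreeEq A n) (g : MonicDegreeEq K p)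

/-- If a monic factor `g` of degree `p` of `f` has coefficients generating `K` over `A`, then
the determinant makes `K` a quotient of the `p`-th exterior power of `A[X]/(f)`. -/
theorem Polynomial.MonicDegreeEq.exists_surjective_exteriorPower
    (hgf : g.1 ∣ f.1.map (algebraMap A K))
    (hK : Algebra.adjoin A (Set.range g.1.coeff) = ⊤) :
    ∃ φ : ⋀[A]^p (AdjoinRoot f.1) →ₗ[A] K, Function.Surjective φ := by
  obtain ⟨b, hb⟩ := AdjoinRoot.nonempty_basis_of_monicDegreeEq g
  have hroot : f.1.aeval (AdjoinRoot.root g.1) = 0 := by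
    obtain ⟨h, hh⟩ := hgf
    rw [← Polynomial.aeval_map_algebraMap K, hh, map_mul, AdjoinRoot.aeval_eq,
      AdjoinRoot.mk_self, zero_mul]
  let ψ : AdjoinRoot f.1 →ₐ[A] AdjoinRoot g.1 :=
    AdjoinRoot.liftAlgHom f.1 (Algebra.ofId _ _) (AdjoinRoot.root g.1) hroot
  have hψ : ψ (AdjoinRoot.root f.1) = AdjoinRoot.root g.1 := AdjoinRoot.liftAlgHom_root ..
  let D : AdjoinRoot f.1 [⋀^Fin p]→ₗ[A] K :=
    { (b.det.toMultilinearMap.restrictScalars A).compLinearMap fun _ ↦ ψ.toLinearMap with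
      map_eq_zero_of_eq' := fun v _ _ hij hne ↦
        b.det.map_eq_zero_of_eq (ψ ∘ v) (congrArg ψ hij) hne }
  have hD (v : Fin p → AdjoinRoot f.1) : D v = (b.toMatrix (ψ ∘ v)).det := rfl
  let φ := exteriorPower.alternatingMapLinearEquiv D
  have hDφ (v : Fin p → AdjoinRoot f.1) : D v ∈ LinearMap.range φ :=
    ⟨exteriorPower.ιMulti A p v, exteriorPower.alternatingMapLinearEquiv_apply_ιMulti D v⟩
  -- Since `g` is the characteristic polynomial of its root, the `k`-th coefficient of the expansion
  -- writes this product as a signed sum of values of `D`, with some entries of `v` multiplied by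
  -- the root of `f`.
  have hmulD (k : ℕ) (v : Fin p → AdjoinRoot f.1) : g.1.coeff k * D v ∈ LinearMap.range φ := by
    have h1 := Matrix.charpoly_mul_C_det (Algebra.leftMulMatrix b (AdjoinRoot.root g.1))
      (b.toMatrix (ψ ∘ v))
    rw [AdjoinRoot.charpoly_leftMulMatrix_root] at h1
    rw [hD, ← coeff_mul_C, h1, finsetSum_coeff]
    refine Submodule.sum_mem _ fun s _ ↦ ?_
    have h2 : (Matrix.of fun j i ↦ if j ∈ s then b.toMatrix (ψ ∘ v) i j else
        (Algebra.leftMulMatrix b (AdjoinRoot.root g.1) * b.toMatrix (ψ ∘ v)) i j).det =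
        D (s.piecewise v fun j ↦ AdjoinRoot.root f.1 * v j) := by
      rw [hD, ← Matrix.det_transpose]
      congr 1
      ext i j
      by_cases hj : j ∈ s
      · simp [hj, Module.Basis.toMatrix_apply]
      · have := congrFun (Algebra.leftMulMatrix_mulVec_repr b (AdjoinRoot.root g.1) (ψ (v j))) i
        simpa [hj, Module.Basis.toMatrix_apply, hψ, Matrix.mul_apply, Matrix.mulVec, dotProduct]
          using this
    -- Only the subsets `s` with `k` elements contribute.
    rw [h2, mul_assoc, coeff_X_pow_mul']
    split_ifs
    · rw [← C_1, ← C_neg, ← C_pow, ← C_mul, coeff_C]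
      split_ifs
      · rcases neg_one_pow_eq_or K sᶜ.card with h | h <;> rw [h]
        · simpa using hDφ _
        · simpa using hDφ _
      · exact zero_mem _
    · exact zero_mem _
  have hmul (k : ℕ) (x : K) (hx : x ∈ LinearMap.range φ) :
      g.1.coeff k * x ∈ LinearMap.range φ := by
    obtain ⟨y, rfl⟩ := hx
    have hy : y ∈ Submodule.span A (Set.range (exteriorPower.ιMulti A p)) := by
      rw [exteriorPower.ιMulti_span]; trivial
    induction hy using Submodule.span_induction with
    | mem y hy =>
      obtain ⟨v, rfl⟩ := hy
      rw [exteriorPower.alternatingMapLinearEquiv_apply_ιMulti]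
      exact hmulD k v
    | zero => simp
    | add y z _ _ hy hz => rw [map_add, mul_add]; exact add_mem hy hz
    | smul a y _ hy => rw [map_smul, mul_smul_comm]; exact Submodule.smul_mem _ a hy
  have hone : (1 : K) ∈ LinearMap.range φ := by
    have : D (fun i ↦ AdjoinRoot.root f.1 ^ (i : ℕ)) = 1 := by
      have h : (ψ ∘ fun i : Fin p ↦ AdjoinRoot.root f.1 ^ (i : ℕ)) = b := by
        funext i
        simp [hψ, hb]
      rw [hD, h, b.toMatrix_self, Matrix.det_one]
    exact this ▸ hDφ _
  refine ⟨φ, fun x ↦ ?_⟩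
  have hx : x ∈ Algebra.adjoin A (Set.range g.1.coeff) := hK ▸ Algebra.mem_top
  suffices ∀ y ∈ LinearMap.range φ, x * y ∈ LinearMap.range φ by simpa using this 1 hone
  induction hx using Algebra.adjoin_induction with
  | mem x hx => obtain ⟨k, rfl⟩ := hx; exact hmul k
  | algebraMap a => intro y hy; rw [← Algebra.smul_def]; exact Submodule.smul_mem _ a hy
  | add x z _ _ hx hz => intro y hy; rw [add_mul]; exact add_mem (hx y hy) (hz y hy)
  | mul x z _ _ hx hz => intro y hy; rw [mul_assoc]; exact hx _ (hz y hy)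

end

theorem Polynomial.MonicDegreeEq.exists_map_eq {R S : Type*} [CommRing R] [CommRing S]
    {n : ℕ} {φ : R →+* S} (hφ : Function.Injective φ) (P : R[X]) (g : MonicDegreeEq S n)
    (h : P.map φ = g.1) : ∃ g' : MonicDegreeEq R n, g'.1 = P := by
  refine ⟨⟨P, hφ ?_, fun i hi ↦ hφ ?_⟩, rfl⟩
  · rw [← coeff_map, h, g.2.1, map_one]
  · rw [← coeff_map, h, g.2.2 i hi, map_zero]

namespace FactorizationRing

variable {A : Type u} [CommRing A] (p q : ℕ) (f : MonicDegreeEq A (p + q))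

/-- Dividing `f` by the monic `g` gives `h`, so the factorization is already defined over the
subalgebra `S` generated by the coefficients of `g`. The universal property yields a map to `S`
whose composite with the inclusion is the identity, so `S` is everything. -/
theorem adjoin_coeff_fstFactor :
    Algebra.adjoin A (Set.range (fstFactor p q f).1.coeff) = ⊤ := by
  set S := Algebra.adjoin A (Set.range (fstFactor p q f).1.coeff)
  have hι : Function.Injective (algebraMap S (FactorizationRing p q f)) := Subtype.val_injective
  obtain ⟨P, hP⟩ : ∃ P : S[X], P.map (algebraMap S (FactorizationRing p q f)) =
      (fstFactor p q f).1 := by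
    rw [← mem_lifts, lifts_iff_coeff_lifts]
    exact fun k ↦ ⟨⟨_, Algebra.subset_adjoin ⟨k, rfl⟩⟩, rfl⟩
  obtain ⟨g, rfl⟩ := MonicDegreeEq.exists_map_eq hι P _ hP
  have hf : (f.1.map (algebraMap A S)).map (algebraMap S (FactorizationRing p q f)) =
      (fstFactor p q f).1 * (sndFactor p q f).1 := by
    rw [Polynomial.map_map, ← IsScalarTower.algebraMap_eq, map_eq_fstFactor_mul_sndFactor]
  have hmod : f.1.map (algebraMap A S) %ₘ g.1 = 0 := by
    apply map_injective _ hι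
    rw [map_modByMonic _ g.monic, hf, hP, Polynomial.map_zero,
      modByMonic_eq_zero_iff_dvd (fstFactor p q f).monic]
    exact dvd_mul_right _ _
  have hdiv := modByMonic_add_div (f.1.map (algebraMap A S)) g.1
  rw [hmod, zero_add] at hdiv
  have hh : (f.1.map (algebraMap A S) /ₘ g.1).map (algebraMap S (FactorizationRing p q f)) =
      (sndFactor p q f).1 := by
    apply (fstFactor p q f).monic.isRegular.left
    dsimp only
    rw [← hf, ← hP, ← Polynomial.map_mul, hdiv]
  obtain ⟨h, hh'⟩ := MonicDegreeEq.exists_map_eq hι _ _ hh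
  rw [← hh'] at hdiv hh
  obtain ⟨φ, hφ1, hφ2⟩ := exists_algHom p q f g h hdiv.symm
  have : S.val.comp φ = AlgHom.id A _ := by
    refine algHom_ext p q f ?_ ?_
    · refine (Polynomial.map_map φ.toRingHom S.val.toRingHom _).symm.trans ?_
      rw [hφ1]
      exact hP.trans (Polynomial.map_id).symm
    · refine (Polynomial.map_map φ.toRingHom S.val.toRingHom _).symm.trans ?_
      rw [hφ2]
      exact hh.trans (Polynomial.map_id).symm
  refine eq_top_iff.mpr fun x _ ↦ ?_
  have hx : (φ x : FactorizationRing p q f) = x := DFunLike.congr_fun this x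
  exact hx ▸ (φ x).2

/-- The factorization ring is free of rank `(p + q).choose p`. -/
theorem nonempty_basis :
    Nonempty (Module.Basis (Fin ((p + q).choose p)) A (FactorizationRing p q f)) := by
  obtain ⟨φ, hφ⟩ := f.exists_surjective_exteriorPower (fstFactor p q f)
    ⟨_, map_eq_fstFactor_mul_sndFactor p q f⟩ (adjoin_coeff_fstFactor p q f)
  obtain ⟨b, -⟩ := AdjoinRoot.nonempty_basis_of_monicDegreeEq f
  have hcard : Fintype.card (Set.powersetCard (Fin (p + q)) p) = (p + q).choose p := by
    rw [← Nat.card_eq_fintype_card, Set.powersetCard.card, Nat.card_fin]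
  let c : Module.Basis (Fin ((p + q).choose p)) A (⋀[A]^p (AdjoinRoot f.1)) :=
    (b.exteriorPower p).reindex (Fintype.equivFinOfCardEq hcard)
  obtain ⟨e, -⟩ := exists_splittingRing_algEquiv p q f
  obtain ⟨bf⟩ := SplittingRing.nonempty_basis f
  obtain ⟨bg⟩ := SplittingRing.nonempty_basis (fstFactor p q f)
  obtain ⟨bh⟩ := SplittingRing.nonempty_basis (sndFactor p q f)
  let ι := Fin p.factorial × Fin q.factorial
  -- Both sides are the splitting ring of `f`, seen over the factorization ring and over `A`.
  let e1 : (ι → FactorizationRing p q f) ≃ₗ[A] (Fin (p + q).factorial → A) :=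
    ((bg.tensorProduct bh).equivFun.symm.restrictScalars A).trans
      (e.symm.toLinearEquiv.trans bf.equivFun)
  have hι : Fintype.card ((_ : ι) × Fin ((p + q).choose p)) = (p + q).factorial := by
    simp only [ι, Fintype.card_sigma, Fintype.card_fin, Finset.sum_const, Finset.card_univ,
      Fintype.card_prod, smul_eq_mul]
    rw [← Nat.add_choose_mul_factorial_mul_factorial p q, Nat.choose_symm_add]
    ring
  let e2 : (ι → ⋀[A]^p (AdjoinRoot f.1)) ≃ₗ[A] (Fin (p + q).factorial → A) :=
    ((Pi.basis fun _ : ι ↦ c).reindex (Fintype.equivFinOfCardEq hι)).equivFun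
  let Φ : (ι → ⋀[A]^p (AdjoinRoot f.1)) →ₗ[A] (ι → FactorizationRing p q f) :=
    φ.compLeft ι
  have hΦ : Function.Surjective Φ := fun y ↦
    ⟨fun i ↦ (hφ (y i)).choose, funext fun i ↦ (hφ (y i)).choose_spec⟩
  have : Module.Finite A (ι → FactorizationRing p q f) := .equiv e1.symm
  -- Comparing `ι` copies lets the known isomorphism of powers be used without cancelling `ι`;
  -- injectivity then restricts to the single copy `i0`.
  have hΦi : Function.Injective Φ := OrzechProperty.injective_of_surjective_of_injective
    (e2.trans e1.symm).toLinearMap Φ (e2.trans e1.symm).injective hΦ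
  have i0 : ι := (⟨0, p.factorial_pos⟩, ⟨0, q.factorial_pos⟩)
  have hφi : Function.Injective φ := fun x y hxy ↦
    congrFun (@hΦi (fun _ ↦ x) (fun _ ↦ y) (funext fun _ ↦ hxy)) i0
  exact ⟨c.map (LinearEquiv.ofBijective φ ⟨hφi, hφ⟩)⟩

instance free : Module.Free A (FactorizationRing p q f) :=
  .of_basis (nonempty_basis p q f).some

end FactorizationRing

end

/-! ### Complete intersection fibres. -/

section

open Polynomial

theorem IsGlobalCompleteIntersection.of_algEquiv {k : Type u} {S : Type v} {T : Type*} [Field k]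
    [CommRing S] [Algebra k S] [CommRing T] [Algebra k T] (e : S ≃ₐ[k] T)
    (h : IsGlobalCompleteIntersection k S) : IsGlobalCompleteIntersection k T := by
  rcases h with h | ⟨n, c, f, ⟨e'⟩, hdim⟩
  · exact .inl e.symm.toEquiv.subsingleton
  · exact .inr ⟨n, c, f, ⟨e.symm.trans e'⟩, by
      rw [← hdim, ringKrullDim_eq_of_ringEquiv e.toRingEquiv]⟩

theorem IsGlobalCompleteIntersection.isLocalCompleteIntersection {k : Type u} {S : Type v}
    [Field k] [CommRing S] [Algebra k S] (h : IsGlobalCompleteIntersection k S) :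
    IsLocalCompleteIntersection k S := by
  refine ⟨{1}, Ideal.span_singleton_one, ?_⟩
  rintro _ rfl
  exact h.of_algEquiv
    ((IsLocalization.atUnit S (Localization.Away (1 : S)) 1 isUnit_one).restrictScalars k)

/-- A finite algebra over a field with a presentation by as many relations as generators is a
global complete intersection. -/
theorem Algebra.Presentation.isGlobalCompleteIntersection {k : Type u} {S : Type v} [Field k]
    [CommRing S] [Algebra k S] [Module.Finite k S] {ι σ : Type*} {n : ℕ}
    (P : Algebra.Presentation k S ι σ) (eι : ι ≃ Fin n) (eσ : σ ≃ Fin n) :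
    IsGlobalCompleteIntersection k S := by
  cases subsingleton_or_nontrivial S
  · exact .inl ‹_›
  refine .inr ⟨n, n, fun i ↦ MvPolynomial.rename eι (P.relation (eσ.symm i)), ⟨?_⟩, ?_⟩
  · refine (P.quotientEquiv.restrictScalars k).symm.trans
      (Ideal.quotientEquivAlg _ _ (MvPolynomial.renameEquiv k eι) ?_)
    rw [← P.span_range_relation_eq_ker, Ideal.map_span, ← Set.range_comp]
    congr 1
    exact (eσ.symm.surjective.range_comp
      (fun i ↦ MvPolynomial.rename eι (P.relation i)))
  -- A nonzero finite algebra over a field has dimension `0 = n - n`.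
  · have : IsArtinianRing S := IsArtinianRing.of_finite k S
    rw [ringKrullDimZero_iff_ringKrullDim_eq_zero.mp inferInstance, zero_add]

namespace FactorizationRing

variable {A : Type u} [CommRing A] (p q : ℕ) (f : MonicDegreeEq A (p + q))

/-- There are `p + q` unknown coefficients and `p + q` equations, a count preserved by base change
to a residue field. -/
theorem isSyntomicAlgebra : IsSyntomicAlgebra A (FactorizationRing p q f) where
  flat := inferInstance
  finitePresentation := inferInstance
  fibre P _ := by
    have : Module.Finite P.ResidueField (P.Fiber (FactorizationRing p q f)) :=
      inferInstanceAs (Module.Finite P.ResidueField (P.ResidueField ⊗[A] FactorizationRing p q f))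
    exact (Algebra.Presentation.isGlobalCompleteIntersection
      ((UniversalFactorizationRing.presentation p q rfl f).toPresentation.baseChange
        P.ResidueField) finSumFinEquiv (Equiv.refl _)).isLocalCompleteIntersection

end FactorizationRing

end

/-! ### Dimension, depth and Serre's conditions along finite flat maps. -/

theorem Ideal.height_le_height_under_of_isIntegral {R S : Type*} [CommRing R] [CommRing S]
    [Algebra R S] [Algebra.IsIntegral R S] (Q : Ideal S) [Q.IsPrime] :
    Q.height ≤ (Q.under R).height := by
  -- Incomparability: a strict chain of primes below `Q` contracts to a strict chain.
  have hm : StrictMono (PrimeSpectrum.comap (algebraMap R S)) := fun I J h ↦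
    Ideal.IsIntegral.comap_lt_comap (R := R) (I := I.asIdeal) (J := J.asIdeal) h
  have h := Order.height_le_height_apply_of_strictMono _ hm ⟨Q, inferInstance⟩
  rwa [← PrimeSpectrum.height_eq_orderHeight, ← PrimeSpectrum.height_eq_orderHeight] at h

/-- Regular sequences stay regular under faithfully flat base change, and a local map keeps them in
the maximal ideal. -/
theorem localRingDepth_le_of_faithfullyFlat (R : Type u) (S : Type v) [CommRing R] [IsLocalRing R]
    [CommRing S] [IsLocalRing S] [Algebra R S] [IsLocalHom (algebraMap R S)] [Module.Flat R S] :
    localRingDepth R ≤ localRingDepth S := by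
  have : Module.FaithfullyFlat R S := Module.FaithfullyFlat.of_flat_of_isLocalHom
  refine iSup₂_le fun rs ⟨hrs, hm⟩ ↦ ?_
  refine le_iSup₂_of_le (rs.map (algebraMap R S)) ⟨hrs.of_faithfullyFlat, fun r hr ↦ ?_⟩ (by simp)
  obtain ⟨a, ha, rfl⟩ := List.mem_map.mp hr
  exact fun h ↦ hm a ha (isUnit_of_map_unit _ _ h)

/-- Dividing by a regular sequence lowers the dimension by exactly its length, and the nonzero
quotient has dimension at least `0`. -/
theorem localRingDepth_le_ringKrullDim (R : Type u) [CommRing R] [IsLocalRing R]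
    [IsNoetherianRing R] : (localRingDepth R : WithBot ℕ∞) ≤ ringKrullDim R := by
  obtain ⟨d, hd⟩ := WithBot.ne_bot_iff_exists.mp (ringKrullDim_ne_bot (R := R))
  rw [← hd, WithBot.coe_le_coe]
  refine iSup₂_le fun rs ⟨hrs, hm⟩ ↦ ?_
  rw [← WithBot.coe_le_coe, hd, ← ringKrullDim_add_length_eq_ringKrullDim_of_isRegular rs hrs]
  have : Nontrivial (R ⧸ Ideal.ofList rs) :=
    Ideal.Quotient.nontrivial_iff.mpr fun h ↦ hrs.2 (by simp [h])
  exact le_add_of_nonneg_left ringKrullDim_nonneg_of_nontrivial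

section

variable (R : Type u) {S : Type v} [CommRing R] [CommRing S] [Algebra R S]

theorem ringKrullDim_localization_le_under [Algebra.IsIntegral R S] (Q : Ideal S) [Q.IsPrime] :
    ringKrullDim (Localization.AtPrime Q) ≤ ringKrullDim (Localization.AtPrime (Q.under R)) := by
  rw [IsLocalization.AtPrime.ringKrullDim_eq_height Q,
    IsLocalization.AtPrime.ringKrullDim_eq_height (Q.under R)]
  exact WithBot.coe_le_coe.mpr Q.height_le_height_under_of_isIntegral

variable [Module.Flat R S]

theorem localRingDepth_localization_under_le (Q : Ideal S) [Q.IsPrime] :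
    localRingDepth (Localization.AtPrime (Q.under R)) ≤ localRingDepth (Localization.AtPrime Q) := by
  let := Localization.AtPrime.algebraOfLiesOver (Q.under R) Q
  have : IsLocalHom (algebraMap (Localization.AtPrime <| Q.under R) (Localization.AtPrime Q)) := by
    rw [RingHom.algebraMap_toAlgebra]
    exact Localization.isLocalHom_localRingHom (Q.under R) Q (algebraMap R S) Ideal.LiesOver.over
  exact localRingDepth_le_of_faithfullyFlat _ _

variable (S)

theorem SerreConditionS.of_flat_of_finite [Module.Finite R S] {k : ℕ} (h : SerreConditionS k R) :
    SerreConditionS k S where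
  noetherian := have := h.noetherian; IsNoetherianRing.of_finite R S
  min_le_depth Q _ := (min_le_min_left _ (ringKrullDim_localization_le_under R Q)).trans <|
    (h.min_le_depth (Q.under R)).trans <|
      WithBot.coe_le_coe.mpr (localRingDepth_localization_under_le R Q)

theorem IsCohenMacaulay.of_flat_of_finite [Module.Finite R S] (h : IsCohenMacaulay R) :
    IsCohenMacaulay S where
  noetherian := have := h.noetherian; IsNoetherianRing.of_finite R S
  depth_eq_dim Q _ := by
    have := h.noetherian
    have : IsNoetherianRing S := IsNoetherianRing.of_finite R S
    -- The hypothesis covers maximal ideals only; integrality ensures that the contraction is one.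
    have : (Q.under R).IsMaximal := Ideal.isMaximal_comap_of_isIntegral_of_isMaximal Q
    refine le_antisymm (localRingDepth_le_ringKrullDim _) ?_
    calc ringKrullDim (Localization.AtPrime Q)
        ≤ ringKrullDim (Localization.AtPrime (Q.under R)) := ringKrullDim_localization_le_under R Q
      _ = localRingDepth (Localization.AtPrime (Q.under R)) := (h.depth_eq_dim (Q.under R)).symm
      _ ≤ _ := WithBot.coe_le_coe.mpr (localRingDepth_localization_under_le R Q)

end

/-! ### Descent of normality. -/

/-- Being an integrally closed domain descends along faithfully flat maps. -/
theorem IsIntegrallyClosed.of_faithfullyFlat (R : Type u) (S : Type v) [CommRing R] [CommRing S]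
    [IsDomain R] [IsDomain S] [Algebra R S] [Module.FaithfullyFlat R S] [IsIntegrallyClosed S] :
    IsIntegrallyClosed R := by
  have hinj : Function.Injective (algebraMap R S) := FaithfulSMul.algebraMap_injective R S
  rw [isIntegrallyClosed_iff (FractionRing R)]
  intro x hx
  obtain ⟨a, b, hb, rfl⟩ := IsFractionRing.div_surjective (A := R) x
  have hb0 : b ≠ 0 := nonZeroDivisors.ne_zero hb
  let φ : FractionRing R →+* FractionRing S :=
    IsFractionRing.map hinj
  have hφ (r : R) : φ (algebraMap R _ r) = algebraMap S _ (algebraMap R S r) :=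
    IsLocalization.map_eq _ r
  have hx' : IsIntegral S (φ (algebraMap R _ a / algebraMap R _ b)) := by
    obtain ⟨P, hP, hP0⟩ := hx
    refine ⟨P.map (algebraMap R S), hP.map _, ?_⟩
    rw [Polynomial.eval₂_map]
    have : (algebraMap S (FractionRing S)).comp (algebraMap R S) =
        φ.comp (algebraMap R (FractionRing R)) := RingHom.ext fun r ↦ (hφ r).symm
    rw [this, ← Polynomial.hom_eval₂, hP0, map_zero]
  obtain ⟨y, hy⟩ := IsIntegrallyClosed.isIntegral_iff.mp hx'
  have hbS : algebraMap S (FractionRing S) (algebraMap R S b) ≠ 0 := by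
    rwa [Ne, FaithfulSMul.algebraMap_eq_zero_iff, FaithfulSMul.algebraMap_eq_zero_iff]
  rw [map_div₀, hφ, hφ, eq_div_iff hbS, ← map_mul] at hy
  have hy' := IsFractionRing.injective S (FractionRing S) hy
  -- In `S` the element `b` divides `a`; faithful flatness gives `bS ∩ R = bR`, so it does in `R`.
  have ha : a ∈ ((Ideal.span {b}).map (algebraMap R S)).comap (algebraMap R S) := by
    rw [Ideal.mem_comap, ← hy', Ideal.map_span, Set.image_singleton]
    exact Ideal.mul_mem_left _ _ (Ideal.mem_span_singleton_self _)
  rw [Ideal.comap_map_eq_self_of_faithfullyFlat] at ha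
  obtain ⟨c, rfl⟩ := Ideal.mem_span_singleton'.mp ha
  refine ⟨c, ?_⟩
  rw [map_mul, mul_div_cancel_right₀]
  rwa [Ne, FaithfulSMul.algebraMap_eq_zero_iff]

/-- Normality descends along faithfully flat maps. -/
theorem IsNormalRing.of_faithfullyFlat (R : Type u) (S : Type v) [CommRing R] [CommRing S]
    [Algebra R S] [Module.FaithfullyFlat R S] (h : IsNormalRing S) : IsNormalRing R := by
  have key (P : Ideal R) [P.IsPrime] : ∃ _ : IsDomain (Localization.AtPrime P),
      IsIntegrallyClosed (Localization.AtPrime P) := by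
    -- With a prime `Q` over `P`, the map of local rings is flat and local, hence faithfully flat.
    obtain ⟨⟨Q, _⟩, hQ⟩ := PrimeSpectrum.comap_surjective_of_faithfullyFlat (B := S) ⟨P, ‹_›⟩
    have hQP : Q.under R = P := congrArg PrimeSpectrum.asIdeal hQ
    subst hQP
    let := Localization.AtPrime.algebraOfLiesOver (Q.under R) Q
    have : IsLocalHom (algebraMap (Localization.AtPrime <| Q.under R) (Localization.AtPrime Q)) := by
      rw [RingHom.algebraMap_toAlgebra]
      exact Localization.isLocalHom_localRingHom (Q.under R) Q (algebraMap R S) Ideal.LiesOver.over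
    have : Module.FaithfullyFlat (Localization.AtPrime (Q.under R)) (Localization.AtPrime Q) :=
      Module.FaithfullyFlat.of_flat_of_isLocalHom
    have := h.isDomain Q
    have := h.isIntegrallyClosed Q
    have hd : IsDomain (Localization.AtPrime (Q.under R)) :=
      (FaithfulSMul.algebraMap_injective _ (Localization.AtPrime Q)).isDomain _
    exact ⟨hd, .of_faithfullyFlat _ (Localization.AtPrime Q)⟩
  exact ⟨fun P _ ↦ (key P).1, fun P _ ↦ (key P).2⟩

/-! ### Faithful flatness of the splitting ring, and the conclusion. -/

namespace FactorizationRing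

open Polynomial

variable {A : Type u} [CommRing A] (p q : ℕ) (f : MonicDegreeEq A (p + q))

/-- The splitting ring is a faithfully flat algebra over the factorization ring. -/
theorem exists_algebra_faithfullyFlat :
    ∃ _ : Algebra (FactorizationRing p q f) (SplittingRing f),
      Module.FaithfullyFlat (FactorizationRing p q f) (SplittingRing f) := by
  obtain ⟨e, -⟩ := exists_splittingRing_algEquiv p q f
  obtain ⟨bg⟩ := SplittingRing.nonempty_basis (fstFactor p q f)
  obtain ⟨bh⟩ := SplittingRing.nonempty_basis (sndFactor p q f)
  let alg : Algebra (FactorizationRing p q f) (SplittingRing f) :=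
    (e.symm.toRingEquiv.toRingHom.comp (algebraMap (FactorizationRing p q f) _)).toAlgebra
  let e' : (SplittingRing (fstFactor p q f) ⊗[FactorizationRing p q f]
      SplittingRing (sndFactor p q f)) ≃ₐ[FactorizationRing p q f] SplittingRing f :=
    AlgEquiv.ofRingEquiv (f := e.symm.toRingEquiv) fun _ ↦ rfl
  let b := (bg.tensorProduct bh).map e'.toLinearEquiv
  -- A free module is faithfully flat once its basis is nonempty.
  have : Nonempty (Fin p.factorial × Fin q.factorial) :=
    ⟨(⟨0, p.factorial_pos⟩, ⟨0, q.factorial_pos⟩)⟩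
  exact ⟨alg, .of_linearEquiv _ _ b.repr⟩

end FactorizationRing

end

theorem mainTheorem11 {A : Type*} [CommRing A] [IsNoetherianRing A] (p q : ℕ)
    (f : Polynomial.MonicDegreeEq A (p + q)) :
    (∃ e : SplittingRing f ≃ₐ[A]
        (SplittingRing (FactorizationRing.fstFactor p q f) ⊗[FactorizationRing p q f]
          SplittingRing (FactorizationRing.sndFactor p q f)),
      (∀ i : Fin p, e (SplittingRing.root f (Fin.castAdd q i)) =
        SplittingRing.root (FactorizationRing.fstFactor p q f) i ⊗ₜ[FactorizationRing p q f] 1) ∧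
      (∀ j : Fin q, e (SplittingRing.root f (Fin.natAdd p j)) =
        1 ⊗ₜ[FactorizationRing p q f] SplittingRing.root (FactorizationRing.sndFactor p q f) j)) ∧
    Nonempty (Module.Basis (Fin ((p + q).choose p)) A (FactorizationRing p q f)) ∧
    IsSyntomicAlgebra A (FactorizationRing p q f) ∧
    (∀ k : ℕ, SerreConditionS k A → SerreConditionS k (FactorizationRing p q f)) ∧
    (IsCohenMacaulay A → IsCohenMacaulay (FactorizationRing p q f)) ∧
    (IsReduced (SplittingRing f) → IsReduced (FactorizationRing p q f)) ∧
    (IsDomain (SplittingRing f) → IsDomain (FactorizationRing p q f)) ∧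
    (IsNormalRing (SplittingRing f) → IsNormalRing (FactorizationRing p q f)) := by
  obtain ⟨_, hff⟩ := FactorizationRing.exists_algebra_faithfullyFlat p q f
  have hinj : Function.Injective
      (algebraMap (FactorizationRing p q f) (SplittingRing f)) :=
    FaithfulSMul.algebraMap_injective _ _
  exact ⟨FactorizationRing.exists_splittingRing_algEquiv p q f,
    FactorizationRing.nonempty_basis p q f, FactorizationRing.isSyntomicAlgebra p q f,
    fun _ h ↦ h.of_flat_of_finite A _, fun h ↦ h.of_flat_of_finite A _,
    fun _ ↦ isReduced_of_injective _ hinj, fun _ ↦ hinj.isDomain _,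
    fun h ↦ h.of_faithfullyFlat _ (SplittingRing f)⟩
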